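/- **Problem (MPMD).** In a metric space $X$, $2m$ requests $u_1,\dots,u_{2m}$ are given online; request $u$ has a position $\mathrm{pos}(u)\in X$ and an arrival time $\mathrm{atime}(u)\ge 0$, with $\mathrm{atime}(u_1)\le\dots\le\mathrm{atime}(u_{2m})$. At any time $\tau$ two requests $u,v$ that have arrived and are not matched yet may be matched, at cost $\mathrm{dist}(\mathrm{pos}(u),\mathrm{pos}(v))+(\tau-\mathrm{atime}(u))+(\tau-\mathrm{atime}(v))$. All requests have to be matched; $\mathrm{Opt}(I)$ is the minimum total cost of an offline solution for the input $I$. **Algorithm Tree Based (TB).** TB maintains a rooted tree $T$ on the positions of the requests received so far. The position of the first request is the root. When a request arrives at a point that is not in $T$, this point is immediately added to $T$ as a new leaf, joined to a closest vertex of $T$. On $T$, TB runs the deterministic tree algorithm of Azar et al.: for a vertex $u$ other than the root, let $e_u$ be the edge from $u$ to its parent, $d(e_u)$ the distance of its endpoints in $X$, and $T_u$ the subtree at $u$. Every edge $e_u$ has a counter, initially $0$, and is saturated when the counter equals $\kappa\, d(e_u)$, where $\kappa>0$ is a fixed constant of the algorithm. The counter of an unsaturated edge $e_u$ increases at unit rate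 while the number of pending (arrived, unmatched) requests in $T_u$ is odd; otherwise it does not change. As soon as all edges of the path in $T$ between the positions of two pending requests are saturated (in particular, if these positions coincide), the two requests are matched and the counters of the edges of this path are reset to $0$. Requests that arrive at the same time are processed one after another. Ties (between closest vertices, and between pairs that can be matched at the same moment) are broken arbitrarily. **Theorem.** The competitive ratio of Tree Based is $2^{\Omega(m)}$, already on a ring. That is, there is an absolute constant $c>0$ such that for every $\kappa>0$ there is $M=M(\kappa)$ such that for all integers $m\ge M$, all $h>0$, and every way of breaking ties, $$\sup_I \frac{\mathrm{TB}(I)}{\mathrm{Opt}(I)}\ \ge\ 2^{cm},$$ where $I$ ranges over the inputs with $2m$ requests and $\mathrm{Opt}(I)>0$ on the continuous ring of length $h$ (with the arc-length distance), and $\mathrm{TB}(I)$ is the total cost of TB on $I$. -/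

import Mathlib

open scoped ENNReal

namespace MPMD

/-- An input of min-cost perfect matching with delays (non-bipartite): `2 m` requests, each with a
position in the metric space and an arrival time, listed in order of arrival. -/
structure Instance (X : Type*) (m : ℕ) where
  pos : Fin (2 * m) → X
  atime : Fin (2 * m) → ℝ
  atime_nonneg : ∀ i, 0 ≤ atime i
  atime_mono : Monotone atime

/-- A record of who is matched with whom (`mate`) and at what time (`mtime`).
A request that is its own mate is not matched. -/
structure Schedule (m : ℕ) where
  mate : Fin (2 * m) → Fin (2 * m)
  mtime : Fin (2 * m) → ℝ

/-- The schedule is a perfect matching of the requests, and both requests of a pair are matched at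
the same time, when both of them have already arrived. -/
structure Schedule.Feasible {X : Type*} {m : ℕ} (S : Schedule m) (I : Instance X m) : Prop where
  invol : ∀ i, S.mate (S.mate i) = i
  matched : ∀ i, S.mate i ≠ i
  same_time : ∀ i, S.mtime (S.mate i) = S.mtime i
  arrived : ∀ i, I.atime i ≤ S.mtime i

/-- Total connection cost plus total waiting cost. A pair at distance `d` pays `d` once: each of
its two requests is charged `d / 2`. -/
noncomputable def Schedule.cost {X : Type*} [MetricSpace X] {m : ℕ}
    (S : Schedule m) (I : Instance X m) : ℝ :=
  ∑ i, (dist (I.pos i) (I.pos (S.mate i)) / 2 + (S.mtime i - I.atime i))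

/-- The cost of an optimal offline solution. -/
noncomputable def Opt {X : Type*} [MetricSpace X] {m : ℕ} (I : Instance X m) : ℝ :=
  sInf {C | ∃ S : Schedule m, S.Feasible I ∧ S.cost I = C}

/-- Supremum, over the inputs with `2 m` requests in `X` that have positive optimal cost, of the
cost of the algorithm divided by the optimal cost; `A I` is the cost of the algorithm on `I`. -/
noncomputable def competitiveRatio {X : Type*} [MetricSpace X] {m : ℕ}
    (A : Instance X m → ℝ) : ℝ≥0∞ :=
  ⨆ (I : Instance X m) (_ : 0 < Opt I), ENNReal.ofReal (A I / Opt I)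

/-! ### Algorithm Tree Based

The tree is rooted at the position of the first request and stored through its parent map: the root
and the points outside of the tree are their own parents. For a tree vertex `u` other than the root,
`e_u` denotes the edge between `u` and `parent u`, of length `dist u (parent u)`, and `T_u` the
subtree hanging at `u`. -/

/-- The state of the algorithm. The requests with index less than `arrived` have been received;
`counter u` is the counter of the edge `e_u`. -/
structure TBState (X : Type*) (m : ℕ) where
  clock : ℝ
  arrived : ℕ
  parent : X → X
  counter : X → ℝ
  sched : Schedule m

/-- Time `0`, no requests, empty tree. -/
def TBState.init (X : Type*) (m : ℕ) : TBState X m where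
  clock := 0
  arrived := 0
  parent := id
  counter := fun _ => 0
  sched := { mate := id, mtime := fun _ => 0 }

/-- `v` belongs to the subtree `T_u`. -/
def Below {X : Type*} (parent : X → X) (v u : X) : Prop := ∃ k : ℕ, parent^[k] v = u

/-- The edge `e_u` lies on the tree path between `v` and `w`: it separates `v` from `w`, i.e.,
exactly one of `v`, `w` belongs to `T_u`. -/
def OnPath {X : Type*} (parent : X → X) (v w u : X) : Prop :=
  Xor (Below parent v u) (Below parent w u)

namespace TBState

/-- Request `i` has arrived and has not been matched yet. -/
def Pending {X : Type*} {m : ℕ} (s : TBState X m) (i : Fin (2 * m)) : Prop :=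
  i.val < s.arrived ∧ s.sched.mate i = i

/-- The vertices of the tree: the positions of the requests received so far. -/
def vertices {X : Type*} {m : ℕ} (s : TBState X m) (I : Instance X m) : Set X :=
  {x | ∃ i : Fin (2 * m), i.val < s.arrived ∧ I.pos i = x}

/-- The edge `e_u` is saturated: its counter has reached `κ` times its length. -/
def Saturated {X : Type*} [MetricSpace X] {m : ℕ} (κ : ℝ) (s : TBState X m) (u : X) : Prop :=
  κ * dist u (s.parent u) ≤ s.counter u

/-- The number of pending requests in `T_u` is odd. -/
def OddBelow {X : Type*} {m : ℕ} (s : TBState X m) (I : Instance X m) (u : X) : Prop :=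
  Odd {i : Fin (2 * m) | s.Pending i ∧ Below s.parent (I.pos i) u}.ncard

/-- The counter of `e_u` is currently increasing. (This never holds for the root and for points
outside of the tree: they are at distance `0` from their parent and have counter `0`.) -/
def Growing {X : Type*} [MetricSpace X] {m : ℕ} (κ : ℝ) (s : TBState X m) (I : Instance X m)
    (u : X) : Prop :=
  s.OddBelow I u ∧ ¬ s.Saturated κ u

/-- `i` and `j` are distinct pending requests and every edge of the tree path between their
positions is saturated (in particular, this holds if they have the same position). -/
def CanMatch {X : Type*} [MetricSpace X] {m : ℕ} (κ : ℝ) (s : TBState X m) (I : Instance X m)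
    (i j : Fin (2 * m)) : Prop :=
  i ≠ j ∧ s.Pending i ∧ s.Pending j ∧
    ∀ u, OnPath s.parent (I.pos i) (I.pos j) u → s.Saturated κ u

open Classical in
/-- `parent'` is the parent map after a request at `x` is received: nothing changes if `x` already
is in the tree; the first point becomes the root; any other new point becomes a leaf that is joined
to a closest vertex of the tree. -/
def Attach {X : Type*} [MetricSpace X] {m : ℕ} (s : TBState X m) (I : Instance X m) (x : X)
    (parent' : X → X) : Prop :=
  ((x ∈ s.vertices I ∨ s.arrived = 0) ∧ parent' = s.parent) ∨
  (x ∉ s.vertices I ∧ ∃ v ∈ s.vertices I, (∀ w ∈ s.vertices I, dist x v ≤ dist x w) ∧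
    parent' = Function.update s.parent x v)

end TBState

open Classical in
/-- The transitions of the algorithm. Two pending requests are matched as soon as all edges on the
tree path between them are saturated, and then the counters of these edges are reset to `0`. If no
matching is possible, the next request is received if its arrival time has come, and otherwise time
passes and the counters of all unsaturated edges `e_u` with an odd number of pending requests in
`T_u` increase at unit rate. -/
inductive TBStep {X : Type*} [MetricSpace X] {m : ℕ} (κ : ℝ) (I : Instance X m) :
    TBState X m → TBState X m → Prop
  | pair (s : TBState X m) (i j : Fin (2 * m)) (h : s.CanMatch κ I i j) :
      TBStep κ I s
        { s with
          counter := fun u => if OnPath s.parent (I.pos i) (I.pos j) u then 0 else s.counter u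
          sched :=
            { mate := Function.update (Function.update s.sched.mate i j) j i
              mtime := Function.update (Function.update s.sched.mtime i s.clock) j s.clock } }
  | arrive (s : TBState X m) (hno : ∀ i j, ¬ s.CanMatch κ I i j)
      (i : Fin (2 * m)) (hi : i.val = s.arrived) (ht : s.clock = I.atime i)
      (parent' : X → X) (hp : s.Attach I (I.pos i) parent') :
      TBStep κ I s { s with arrived := s.arrived + 1, parent := parent' }
  | wait (s : TBState X m) (hno : ∀ i j, ¬ s.CanMatch κ I i j)
      (δ : ℝ) (hδ : 0 < δ)
      (harr : ∀ i : Fin (2 * m), i.val = s.arrived → s.clock + δ ≤ I.atime i)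
      (hsat : ∀ u, s.Growing κ I u → s.counter u + δ ≤ κ * dist u (s.parent u)) :
      TBStep κ I s
        { s with
          clock := s.clock + δ
          counter := fun u => if s.Growing κ I u then s.counter u + δ else s.counter u }

/-- `C` is the cost of a complete run of the algorithm on `I`: a run that starts in the initial
state and ends when all requests have arrived and are matched. -/
def IsTBCost {X : Type*} [MetricSpace X] {m : ℕ} (κ : ℝ) (I : Instance X m) (C : ℝ) : Prop :=
  ∃ s : TBState X m, Relation.ReflTransGen (TBStep κ I) (TBState.init X m) s ∧
    s.arrived = 2 * m ∧ (∀ i, s.sched.mate i ≠ i) ∧ s.sched.cost I = C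

/-- `A I` is the cost of Tree Based on `I`, for some way of breaking ties (between closest tree
vertices, and between pairs that can be matched at the same moment). The values of `A` are
constrained only on inputs for which a complete run exists, so this cannot fail for all `A`. -/
def IsTreeBased {X : Type*} [MetricSpace X] {m : ℕ} (κ : ℝ) (A : Instance X m → ℝ) : Prop :=
  ∀ I, (∃ C, IsTBCost κ I C) → IsTBCost κ I (A I)

end MPMD

/-! The tree can be forced to wind around the ring. Let `P j` lie at arc-length h(1 - (2/3)^j). The
step from `P j` to `P (j + 1)` is half the remaining arc from `P (j + 1)` on to the origin, so each
new point is strictly closest to its predecessor. Hence the tree is the path `P 0`, `P 1`, ...,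
however ties are broken, although its far end comes back close to the root `P 0`.

Two requests at each of `P 0`, ..., `P (m - 2)` build this path and are matched at once for free.
The last two requests, at `P (m - 1)` and `P 0`, are at distance at most h(2/3)^(m - 1), which
bounds the optimum. Tree Based can match them only when the whole path is saturated, in particular
its first edge, of length at least h/3; counters grow at unit rate, so this takes time at least
κh/3. The ratio is at least of order κ(3/2)^m.

`IsChain.invariant_step` carries the lower bound, for every run; `IsChain.exists_cost` supplies a
complete run, without which `IsTreeBased` says nothing; `isChain_ringChain` is the geometry. -/

namespace MPMD

/-! ### The input built on a chain of points. -/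

section Runs

variable {X : Type*}

theorem iterate_parent_chain {P : ℕ → X} {parent : X → X} {n : ℕ}
    (hp : ∀ j, 2 * j ≤ n - 1 → parent (P j) = P (j - 1)) (k : ℕ) :
    ∀ j, 2 * j ≤ n - 1 → parent^[k] (P j) = P (j - k) := by
  induction k with
  | zero => intro j _; rfl
  | succ k ih =>
    intro j hj
    rw [Function.iterate_succ_apply, hp j hj, ih (j - 1) (by omega)]
    congr 1
    omega

/-- Two requests at each of `P 0, …, P (m - 2)`, then one at `P (m - 1)` and one at `P 0`, all of
them arriving at time `0`. -/
def chainInstance (P : ℕ → X) (m : ℕ) : Instance X m where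
  pos i := if i.val + 1 = 2 * m then P 0 else P (i.val / 2)
  atime _ := 0
  atime_nonneg _ := le_rfl
  atime_mono _ _ _ := le_rfl

theorem chainInstance_pos_eq (P : ℕ → X) {m : ℕ} {i j : Fin (2 * m)}
    (hij : i.val / 2 = j.val / 2) (hi : i.val / 2 + 1 < m) :
    (chainInstance P m).pos i = (chainInstance P m).pos j := by
  simp only [chainInstance]
  rw [if_neg (by omega), if_neg (by omega), hij]

theorem chainInstance_pos_mem (P : ℕ → X) {m : ℕ} (i : Fin (2 * m)) {n : ℕ} (hi : i.val < n) :
    ∃ j, 2 * j < n ∧ j < m ∧ (chainInstance P m).pos i = P j := by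
  simp only [chainInstance]
  split_ifs with h
  · exact ⟨0, by omega, by omega, rfl⟩
  · exact ⟨i.val / 2, by omega, by omega, rfl⟩

theorem chainInstance_mem_vertices {P : ℕ → X} {m : ℕ} {s : TBState X m}
    (hle : s.arrived ≤ 2 * m) {x : X} :
    x ∈ s.vertices (chainInstance P m) ↔ ∃ j, 2 * j < s.arrived ∧ x = P j := by
  constructor
  · rintro ⟨i, hi, rfl⟩
    obtain ⟨j, hj, -, h⟩ := chainInstance_pos_mem P i hi
    exact ⟨j, hj, h⟩
  · rintro ⟨j, hj, rfl⟩
    refine ⟨⟨2 * j, by omega⟩, hj, ?_⟩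
    simp only [chainInstance]
    rw [if_neg (by omega)]
    congr 1
    omega

/-! ### The invariant of all runs on a chain. -/

variable [MetricSpace X]

/-- Each point of the sequence is strictly closer to its predecessor than to all earlier points. -/
structure IsChain (P : ℕ → X) : Prop where
  inj : Function.Injective P
  closest : ∀ i j, i < j → dist (P (j + 1)) (P j) < dist (P (j + 1)) (P i)

/-- What holds in every state of a run of Tree Based on `chainInstance P m`. -/
structure ChainInvariant (κ : ℝ) (P : ℕ → X) {m : ℕ} (s : TBState X m) : Prop where
  clock_nonneg : 0 ≤ s.clock
  clock_zero : s.arrived < 2 * m → s.clock = 0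
  counter_le : ∀ u, s.counter u ≤ s.clock
  mtime_nonneg : ∀ i, 0 ≤ s.sched.mtime i
  arrived_le : s.arrived ≤ 2 * m
  parent_eq : ∀ j, 2 * j ≤ s.arrived - 1 → s.parent (P j) = P (j - 1)
  pending : ∀ i, s.Pending i → s.arrived ≤ 2 * (i.val / 2) + 2
  arrived_of_matched : ∀ i, s.sched.mate i ≠ i → i.val < s.arrived
  partner_matched : ∀ i j, i.val / 2 = j.val / 2 → s.sched.mate i ≠ i → s.sched.mate j ≠ j
  late : ∀ i, i.val / 2 + 1 = m → s.sched.mate i ≠ i → κ * dist (P 1) (P 0) ≤ s.sched.mtime i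

theorem ChainInvariant.init (κ : ℝ) (P : ℕ → X) (m : ℕ) :
    ChainInvariant κ P (TBState.init X m) where
  clock_nonneg := le_rfl
  clock_zero _ := rfl
  counter_le _ := le_rfl
  mtime_nonneg _ := le_rfl
  arrived_le := Nat.zero_le _
  parent_eq j hj := by
    -- Truncated subtraction leaves only `j = 0` here, and the claim says that the root is its own
    -- parent.
    obtain rfl : j = 0 := by simpa [TBState.init] using hj
    rfl
  pending _ hi := absurd hi.1 (Nat.not_lt_zero _)
  arrived_of_matched _ hi := absurd rfl hi
  partner_matched _ _ _ hi := absurd rfl hi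
  late _ _ hi := absurd rfl hi

/-- A pending request has arrived, yet no request of a later pair has; this determines its pair from
`arrived`. -/
theorem ChainInvariant.same_pair {κ : ℝ} {P : ℕ → X} {m : ℕ} {s : TBState X m}
    (hs : ChainInvariant κ P s) {i j : Fin (2 * m)} (hi : s.Pending i) (hj : s.Pending j) :
    i.val / 2 = j.val / 2 := by
  have h1 := hs.pending i hi
  have h2 := hs.pending j hj
  have h3 := hi.1
  have h4 := hj.1
  omega

theorem ChainInvariant.exists_partner {κ : ℝ} {P : ℕ → X} {m : ℕ} {s : TBState X m}
    (hs : ChainInvariant κ P s) {i : Fin (2 * m)} (hi : s.Pending i)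
    (ha : s.arrived = 2 * (i.val / 2) + 2) :
    ∃ j, i ≠ j ∧ s.Pending j ∧ i.val / 2 = j.val / 2 := by
  have hle := hs.arrived_le
  obtain ⟨j, hne, hj⟩ : ∃ j : Fin (2 * m), i ≠ j ∧ i.val / 2 = j.val / 2 := by
    rcases Nat.mod_two_eq_zero_or_one i.val with h | h
    · exact ⟨⟨i.val + 1, by omega⟩, by simp [Fin.ext_iff], by simp only; omega⟩
    · exact ⟨⟨i.val - 1, by omega⟩, by simp only [ne_eq, Fin.ext_iff]; omega, by simp only; omega⟩
  refine ⟨j, hne, ⟨by omega, ?_⟩, hj⟩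
  by_contra h
  exact hs.partner_matched j i hj.symm h hi.2

/-- Once both requests of a pair other than the last have arrived, they share a position and can be
matched along an empty path. So each such pair is gone before the next request is received. -/
theorem ChainInvariant.arrived_lt_of_no_match {κ : ℝ} {P : ℕ → X} {m : ℕ} {s : TBState X m}
    (hs : ChainInvariant κ P s) (hno : ∀ i j, ¬ s.CanMatch κ (chainInstance P m) i j)
    (ha : s.arrived < 2 * m) {i : Fin (2 * m)} (hi : s.Pending i) :
    s.arrived < 2 * (i.val / 2) + 2 := by
  refine lt_of_le_of_ne (hs.pending i hi) fun h => ?_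
  obtain ⟨j, hne, hj, hij⟩ := hs.exists_partner hi h
  refine hno i j ⟨hne, hi, hj, fun u hu => ?_⟩
  rw [chainInstance_pos_eq P hij (by omega)] at hu
  simp [OnPath] at hu

theorem ChainInvariant.below_iff {κ : ℝ} {P : ℕ → X} {m : ℕ} {s : TBState X m}
    (hs : ChainInvariant κ P s) {j : ℕ} (hj : 2 * j < s.arrived) {u : X} :
    Below s.parent (P j) u ↔ ∃ k ≤ j, u = P k := by
  constructor
  · rintro ⟨k, rfl⟩
    exact ⟨j - k, Nat.sub_le _ _, iterate_parent_chain hs.parent_eq k j (by omega)⟩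
  · rintro ⟨k, hk, rfl⟩
    refine ⟨j - k, ?_⟩
    rw [iterate_parent_chain hs.parent_eq _ j (by omega)]
    congr 1
    omega

/-- Below `P 1` lies the whole chain except the root, so the first edge separates the last two
requests. -/
theorem ChainInvariant.onPath_last {κ : ℝ} {P : ℕ → X} (hP : IsChain P) {m : ℕ} (hm : 2 ≤ m)
    {s : TBState X m} (hs : ChainInvariant κ P s) {i j : Fin (2 * m)} (hij : i ≠ j)
    (hi : s.Pending i) (hj : s.Pending j) (hlast : i.val / 2 + 1 = m) :
    OnPath s.parent ((chainInstance P m).pos i) ((chainInstance P m).pos j) (P 1) := by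
  have h1 := hs.same_pair hi hj
  have h2 := hi.1
  have h3 := hj.1
  have hne : i.val ≠ j.val := fun h => hij (Fin.ext h)
  have ha : 2 * (m - 1) < s.arrived := by omega
  have hB : Below s.parent (P (m - 1)) (P 1) := (hs.below_iff ha).2 ⟨1, by omega, rfl⟩
  have hN : ¬ Below s.parent (P 0) (P 1) := by
    rw [hs.below_iff (by omega)]
    rintro ⟨k, hk, h⟩
    have := hP.inj h
    omega
  simp only [OnPath, chainInstance]
  rcases Nat.lt_or_gt_of_ne hne with h | h
  · rw [if_neg (by omega), if_pos (by omega), show i.val / 2 = m - 1 by omega]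
    exact Or.inl ⟨hB, hN⟩
  · rw [if_pos (by omega), if_neg (by omega), show j.val / 2 = m - 1 by omega]
    exact Or.inr ⟨hB, hN⟩

theorem IsChain.parent_attach {κ : ℝ} {P : ℕ → X} (hP : IsChain P) {m : ℕ}
    {s : TBState X m} (hs : ChainInvariant κ P s) {i : Fin (2 * m)} (hi : i.val = s.arrived)
    {parent' : X → X} (hp : s.Attach (chainInstance P m) ((chainInstance P m).pos i) parent') :
    ∀ j, 2 * j ≤ s.arrived + 1 - 1 → parent' (P j) = P (j - 1) := by
  classical
  intro j hj
  have hle := hs.arrived_le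
  rcases hp with ⟨h, rfl⟩ | ⟨hx, v, hv, hmin, rfl⟩
  -- The only new index has `2 * j = arrived`, with `arrived` positive. Then the incoming request is
  -- the first one at `P j`, so its point cannot be in the tree already.
  · by_cases hj' : 2 * j ≤ s.arrived - 1
    · exact hs.parent_eq j hj'
    exfalso
    have hpos : (chainInstance P m).pos i = P j := by
      simp only [chainInstance]
      rw [if_neg (by omega)]
      congr 1
      omega
    rcases h with h | h
    · rw [hpos, chainInstance_mem_vertices hle] at h
      obtain ⟨k, hk, hk'⟩ := h
      have := hP.inj hk'
      omega
    · omega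
  · rw [chainInstance_mem_vertices hle] at hx hv
    have hpos : (chainInstance P m).pos i = P (i.val / 2) := by
      simp only [chainInstance]
      -- The very last request returns to `P 0`, which is already a vertex, so it never adds a leaf.
      rw [if_neg]
      intro h
      apply hx
      refine ⟨0, by omega, ?_⟩
      simp [chainInstance, h]
    have heven : s.arrived = 2 * (i.val / 2) := by
      by_contra h
      exact hx ⟨i.val / 2, by omega, hpos⟩
    rw [hpos] at hmin ⊢
    by_cases hj' : j = i.val / 2
    · subst hj'
      rw [Function.update_self]
      obtain ⟨k, hk, rfl⟩ := hv
      -- The strict inequality in `IsChain` leaves no tie between closest vertices.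
      by_contra hne
      have hk' : k < i.val / 2 - 1 := by
        have : k ≠ i.val / 2 - 1 := fun h => hne (by rw [h])
        omega
      have h1 := hP.closest k (i.val / 2 - 1) hk'
      have h2 := hmin (P (i.val / 2 - 1))
        ((chainInstance_mem_vertices hle).2 ⟨i.val / 2 - 1, by omega, rfl⟩)
      rw [show i.val / 2 - 1 + 1 = i.val / 2 by omega] at h1
      exact absurd h2 (not_le.2 h1)
    · rw [Function.update_of_ne (fun h => hj' (hP.inj h))]
      exact hs.parent_eq j (by omega)

theorem IsChain.invariant_step {κ : ℝ} {P : ℕ → X} (hP : IsChain P) {m : ℕ} (hm : 2 ≤ m)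
    {s t : TBState X m} (hs : ChainInvariant κ P s)
    (hst : TBStep κ (chainInstance P m) s t) : ChainInvariant κ P t := by
  classical
  have hle := hs.arrived_le
  cases hst with
  | pair i j h =>
    obtain ⟨hij, hi, hj, hsat⟩ := h
    have hpair := hs.same_pair hi hj
    have hmate : ∀ k, Function.update (Function.update s.sched.mate i j) j i k ≠ k ↔
        k = i ∨ k = j ∨ s.sched.mate k ≠ k := by
      intro k
      by_cases h1 : k = j
      · subst h1; simp [hij]
      by_cases h2 : k = i
      · subst h2; simp [hij, Ne.symm hij]
      simp [h1, h2]
    have hmtime : ∀ k, Function.update (Function.update s.sched.mtime i s.clock) j s.clock k =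
        if k = i ∨ k = j then s.clock else s.sched.mtime k := by
      intro k
      by_cases h1 : k = j
      · subst h1; simp
      by_cases h2 : k = i
      · subst h2; simp [hij]
      simp [h1, h2]
    exact
    { clock_nonneg := hs.clock_nonneg
      clock_zero := hs.clock_zero
      counter_le := fun u => by
        dsimp only
        split_ifs
        · exact hs.clock_nonneg
        · exact hs.counter_le u
      mtime_nonneg := fun k => by
        dsimp only
        rw [hmtime]
        split_ifs
        · exact hs.clock_nonneg
        · exact hs.mtime_nonneg k
      arrived_le := hle
      parent_eq := hs.parent_eq
      pending := fun k hk => by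
        refine hs.pending k ⟨hk.1, ?_⟩
        by_contra hne
        exact (hmate k).2 (Or.inr (Or.inr hne)) hk.2
      arrived_of_matched := fun k hk => by
        rcases (hmate k).1 hk with rfl | rfl | hk
        · exact hi.1
        · exact hj.1
        · exact hs.arrived_of_matched k hk
      partner_matched := fun k l hkl hk => by
        refine (hmate l).2 ?_
        -- The two requests being matched are distinct and form a whole pair.
        have key : k = i ∨ k = j → l = i ∨ l = j := by
          have : i.val ≠ j.val := fun h => hij (Fin.ext h)
          rw [Fin.ext_iff, Fin.ext_iff, Fin.ext_iff, Fin.ext_iff]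
          omega
        rcases (hmate k).1 hk with h | h | h
        · exact or_assoc.1 (Or.inl (key (Or.inl h)))
        · exact or_assoc.1 (Or.inl (key (Or.inr h)))
        · exact Or.inr (Or.inr (hs.partner_matched k l hkl h))
      late := fun k hk hk' => by
        dsimp only
        rw [hmtime]
        split_ifs with h
        · have hlast : i.val / 2 + 1 = m := by rcases h with rfl | rfl <;> omega
          -- Saturation of the first edge gives κ times its length as a lower bound on its counter,
          -- hence on the clock, which is the matching time.
          have h1 := hsat _ (hs.onPath_last hP hm hij hi hj hlast)
          have h2 := hi.1
          have h3 := hj.1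
          have h4 : i.val ≠ j.val := fun h => hij (Fin.ext h)
          have hpar := hs.parent_eq 1 (by omega)
          simp only [TBState.Saturated, hpar] at h1
          exact h1.trans (hs.counter_le _)
        · refine hs.late k hk ?_
          rcases (hmate k).1 hk' with h' | h' | h'
          · exact absurd (Or.inl h') h
          · exact absurd (Or.inr h') h
          · exact h' }
  | arrive hno i hi ht parent' hp =>
    have hclock : s.clock = 0 := ht
    exact
    { clock_nonneg := hs.clock_nonneg
      clock_zero := fun _ => hclock
      counter_le := hs.counter_le
      mtime_nonneg := hs.mtime_nonneg
      arrived_le := by have := i.isLt; dsimp only; omega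
      parent_eq := hP.parent_attach hs hi hp
      pending := fun k hk => by
        have hk1 : k.val < s.arrived + 1 := hk.1
        dsimp only
        by_cases h : k.val < s.arrived
        · exact hs.arrived_lt_of_no_match hno (by omega) ⟨h, hk.2⟩
        · omega
      arrived_of_matched := fun k hk => (hs.arrived_of_matched k hk).trans (Nat.lt_succ_self _)
      partner_matched := hs.partner_matched
      late := hs.late }
  | wait hno δ hδ harr hsat =>
    -- All arrival times are 0, so no time can pass while a request is still to be received.
    have ha : s.arrived = 2 * m := by
      by_contra h
      have h1 : s.clock + δ ≤ 0 := harr ⟨s.arrived, by omega⟩ rfl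
      linarith [hs.clock_nonneg]
    exact
    { clock_nonneg := by have := hs.clock_nonneg; dsimp only; linarith
      clock_zero := fun h => absurd h (by dsimp only; omega)
      counter_le := fun u => by
        have := hs.counter_le u
        dsimp only
        split_ifs <;> linarith
      mtime_nonneg := hs.mtime_nonneg
      arrived_le := hle
      parent_eq := hs.parent_eq
      pending := hs.pending
      arrived_of_matched := hs.arrived_of_matched
      partner_matched := hs.partner_matched
      late := hs.late }

theorem IsChain.invariant_of_run {κ : ℝ} {P : ℕ → X} (hP : IsChain P) {m : ℕ} (hm : 2 ≤ m)
    {s : TBState X m}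
    (hrun : Relation.ReflTransGen (TBStep κ (chainInstance P m)) (TBState.init X m) s) :
    ChainInvariant κ P s := by
  induction hrun with
  | refl => exact ChainInvariant.init κ P m
  | tail _ hst ih => exact hP.invariant_step hm ih hst

/-! ### The cost of every complete run. -/

theorem IsChain.le_cost {κ : ℝ} {P : ℕ → X} (hP : IsChain P) {m : ℕ} (hm : 2 ≤ m) {C : ℝ}
    (hC : IsTBCost κ (chainInstance P m) C) : κ * dist (P 1) (P 0) ≤ C := by
  obtain ⟨s, hrun, -, hmate, rfl⟩ := hC
  have hs := hP.invariant_of_run hm hrun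
  have hterm : ∀ k, s.sched.mtime k ≤ dist ((chainInstance P m).pos k)
      ((chainInstance P m).pos (s.sched.mate k)) / 2 +
      (s.sched.mtime k - (chainInstance P m).atime k) := by
    intro k
    have := dist_nonneg (x := (chainInstance P m).pos k)
      (y := (chainInstance P m).pos (s.sched.mate k))
    simp only [chainInstance] at this ⊢
    linarith
  -- The waiting time of the request at `P (m - 1)` alone suffices.
  let r : Fin (2 * m) := ⟨2 * m - 2, by omega⟩
  calc κ * dist (P 1) (P 0) ≤ s.sched.mtime r :=
        hs.late r (by simp only [r]; omega) (hmate r)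
    _ ≤ _ := hterm r
    _ ≤ _ := Finset.single_le_sum (f := fun k => dist ((chainInstance P m).pos k)
        ((chainInstance P m).pos (s.sched.mate k)) / 2 +
        (s.sched.mtime k - (chainInstance P m).atime k))
        (fun k _ => (hs.mtime_nonneg k).trans (hterm k)) (Finset.mem_univ r)

/-! ### Complete runs exist -/

theorem ChainInvariant.eq_or_eq_of_pending {κ : ℝ} {P : ℕ → X} {m : ℕ} {s : TBState X m}
    (hs : ChainInvariant κ P s) {i j : Fin (2 * m)} (hij : i ≠ j) (hi : s.Pending i)
    (hj : s.Pending j) {k : Fin (2 * m)} (hk : s.Pending k) : k = i ∨ k = j := by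
  have h1 := hs.same_pair hi hj
  have h2 := hs.same_pair hi hk
  have h3 : i.val ≠ j.val := fun h => hij (Fin.ext h)
  rw [Fin.ext_iff, Fin.ext_iff]
  omega

theorem TBState.exists_attach {m : ℕ} (s : TBState X m) (I : Instance X m)
    (hle : s.arrived ≤ 2 * m) (x : X) : ∃ parent', s.Attach I x parent' := by
  classical
  by_cases h : x ∈ s.vertices I ∨ s.arrived = 0
  · exact ⟨_, Or.inl ⟨h, rfl⟩⟩
  · push Not at h
    have hfin : (s.vertices I).Finite :=
      (Set.finite_range I.pos).subset (by rintro _ ⟨i, _, rfl⟩; exact ⟨i, rfl⟩)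
    have hne : (s.vertices I).Nonempty := ⟨_, ⟨0, by omega⟩, Nat.pos_of_ne_zero h.2, rfl⟩
    obtain ⟨v, hv, hmin⟩ := Set.exists_min_image _ (fun w => dist x w) hfin hne
    exact ⟨_, Or.inr ⟨h.1, v, hv, hmin, rfl⟩⟩

/-- A step that matches two pending requests leaves no pending request. -/
theorem ChainInvariant.exists_pair_step {κ : ℝ} {P : ℕ → X} {m : ℕ} {s : TBState X m}
    (hs : ChainInvariant κ P s) {i j : Fin (2 * m)}
    (h : s.CanMatch κ (chainInstance P m) i j) :
    ∃ t, TBStep κ (chainInstance P m) s t ∧ t.arrived = s.arrived ∧ ∀ k, ¬ t.Pending k := by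
  classical
  refine ⟨_, TBStep.pair s i j h, rfl, fun k hk => ?_⟩
  obtain ⟨hij, hi, hj, -⟩ := h
  have h2 : Function.update (Function.update s.sched.mate i j) j i k = k := hk.2
  have h3 : k = i ∨ k = j := by
    by_contra hne
    push Not at hne
    rw [Function.update_of_ne hne.2, Function.update_of_ne hne.1] at h2
    rcases hs.eq_or_eq_of_pending hij hi hj ⟨hk.1, h2⟩ with rfl | rfl
    · exact hne.1 rfl
    · exact hne.2 rfl
  rcases h3 with rfl | rfl
  · rw [Function.update_of_ne hij, Function.update_self] at h2
    exact hij h2.symm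
  · rw [Function.update_self] at h2
    exact hij h2

theorem IsChain.exists_run_arrived {κ : ℝ} {P : ℕ → X} (hP : IsChain P) {m : ℕ} (hm : 2 ≤ m) :
    ∀ n ≤ 2 * m, ∃ s : TBState X m,
      Relation.ReflTransGen (TBStep κ (chainInstance P m)) (TBState.init X m) s ∧
        s.arrived = n := by
  intro n
  induction n with
  | zero => exact fun _ => ⟨_, .refl, rfl⟩
  | succ n ih =>
    intro hn
    obtain ⟨s, hrun, ha⟩ := ih (by omega)
    obtain ⟨t, hrun', ha', hno⟩ : ∃ t : TBState X m,
        Relation.ReflTransGen (TBStep κ (chainInstance P m)) (TBState.init X m) t ∧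
          t.arrived = n ∧ ∀ i j, ¬ t.CanMatch κ (chainInstance P m) i j := by
      -- At most one match is due between arrivals, since it leaves nothing pending.
      by_cases h : ∃ i j, s.CanMatch κ (chainInstance P m) i j
      · obtain ⟨i, j, h⟩ := h
        obtain ⟨t, hst, ha', hno⟩ := (hP.invariant_of_run hm hrun).exists_pair_step h
        exact ⟨t, hrun.tail hst, ha'.trans ha, fun i j hc => hno i hc.2.1⟩
      · push Not at h
        exact ⟨s, hrun, ha, h⟩
    have ht := hP.invariant_of_run hm hrun'
    obtain ⟨parent', hp⟩ := t.exists_attach (chainInstance P m) ht.arrived_le ((chainInstance P m).pos ⟨n, hn⟩)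
    exact ⟨_, hrun'.tail (TBStep.arrive t hno ⟨n, hn⟩ ha'.symm
      (ht.clock_zero (by omega)) parent' hp), by simp only [ha']⟩

/-- An odd count is nonzero, so a growing edge lies above a pending request and hence on the chain.
Finiteness makes the next saturation time a minimum. -/
theorem ChainInvariant.finite_growing {κ : ℝ} {P : ℕ → X} {m : ℕ} {s : TBState X m}
    (hs : ChainInvariant κ P s) : {u | s.Growing κ (chainInstance P m) u}.Finite := by
  refine ((Finset.range m).finite_toSet.image P).subset ?_
  rintro u ⟨hodd, -⟩
  have hne := hodd.pos.ne'
  obtain ⟨i, hi, hbelow⟩ := Set.nonempty_of_ncard_ne_zero hne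
  obtain ⟨j, hj, hjm, hpos⟩ := chainInstance_pos_mem P i hi.1
  rw [hpos, hs.below_iff hj] at hbelow
  obtain ⟨k, hk, rfl⟩ := hbelow
  exact ⟨k, by simp only [Finset.coe_range, Set.mem_Iio]; omega, rfl⟩

/-- If two requests are pending, then the counters of all unsaturated edges between them grow. -/
theorem ChainInvariant.oddBelow {κ : ℝ} {P : ℕ → X} {m : ℕ} {s : TBState X m}
    (hs : ChainInvariant κ P s) {i j : Fin (2 * m)} (hij : i ≠ j) (hi : s.Pending i)
    (hj : s.Pending j) {u : X}
    (hu : OnPath s.parent ((chainInstance P m).pos i) ((chainInstance P m).pos j) u) :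
    s.OddBelow (chainInstance P m) u := by
  have key : ∃ k, {i | s.Pending i ∧ Below s.parent ((chainInstance P m).pos i) u} = {k} := by
    rcases hu with ⟨h1, h2⟩ | ⟨h1, h2⟩
    · refine ⟨i, Set.eq_singleton_iff_unique_mem.2 ⟨⟨hi, h1⟩, ?_⟩⟩
      rintro k ⟨hk, hb⟩
      rcases hs.eq_or_eq_of_pending hij hi hj hk with rfl | rfl
      · rfl
      · exact absurd hb h2
    · refine ⟨j, Set.eq_singleton_iff_unique_mem.2 ⟨⟨hj, h1⟩, ?_⟩⟩
      rintro k ⟨hk, hb⟩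
      rcases hs.eq_or_eq_of_pending hij hi hj hk with rfl | rfl
      · exact absurd hb h2
      · rfl
  obtain ⟨k, hk⟩ := key
  rw [TBState.OddBelow, hk, Set.ncard_singleton]
  exact odd_one

theorem ChainInvariant.exists_wait_step {κ : ℝ} {P : ℕ → X} {m : ℕ} {s : TBState X m}
    (hs : ChainInvariant κ P s) (ha : s.arrived = 2 * m)
    (hno : ∀ i j, ¬ s.CanMatch κ (chainInstance P m) i j) {i : Fin (2 * m)}
    (hi : s.Pending i) :
    ∃ t, TBStep κ (chainInstance P m) s t ∧ t.arrived = s.arrived ∧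
      {u | t.Growing κ (chainInstance P m) u}.ncard <
        {u | s.Growing κ (chainInstance P m) u}.ncard := by
  classical
  have h1 := hs.pending i hi
  obtain ⟨j, hij, hj, -⟩ := hs.exists_partner hi (by omega)
  have hne : {u | s.Growing κ (chainInstance P m) u}.Nonempty := by
    by_contra hempty
    refine hno i j ⟨hij, hi, hj, fun u hu => ?_⟩
    by_contra hsat
    exact hempty ⟨u, hs.oddBelow hij hi hj hu, hsat⟩
  obtain ⟨v, hv, hmin⟩ := Set.exists_min_image _
    (fun u => κ * dist u (s.parent u) - s.counter u) hs.finite_growing hne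
  have hv2 := hv.2
  simp only [TBState.Saturated, not_le] at hv2
  refine ⟨_, TBStep.wait s hno (κ * dist v (s.parent v) - s.counter v) (by linarith)
    (fun i hi => absurd i.isLt (by omega)) (fun u hu => ?_), rfl, ?_⟩
  · have := hmin u hu
    linarith
  · refine Set.ncard_lt_ncard ⟨?_, fun hsub => ?_⟩ hs.finite_growing
    · rintro u ⟨hu1, hu2⟩
      refine ⟨hu1, fun hsat => hu2 ?_⟩
      simp only [TBState.Saturated] at hsat ⊢
      split_ifs <;> linarith
    · have h2 := (hsub hv).2
      simp only [TBState.Saturated] at h2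
      rw [if_pos (show s.Growing κ (chainInstance P m) v from hv)] at h2
      exact h2 (by linarith)

theorem IsChain.exists_cost {κ : ℝ} {P : ℕ → X} (hP : IsChain P) {m : ℕ} (hm : 2 ≤ m) :
    ∃ C, IsTBCost κ (chainInstance P m) C := by
  suffices H : ∀ n, ∀ s : TBState X m,
      Relation.ReflTransGen (TBStep κ (chainInstance P m)) (TBState.init X m) s →
      s.arrived = 2 * m → {u | s.Growing κ (chainInstance P m) u}.ncard ≤ n →
      ∃ C, IsTBCost κ (chainInstance P m) C by
    obtain ⟨s, hrun, ha⟩ := hP.exists_run_arrived (κ := κ) hm (2 * m) le_rfl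
    exact H _ s hrun ha le_rfl
  have hdone : ∀ s : TBState X m,
      Relation.ReflTransGen (TBStep κ (chainInstance P m)) (TBState.init X m) s →
      s.arrived = 2 * m → (∀ k, ¬ s.Pending k) → ∃ C, IsTBCost κ (chainInstance P m) C :=
    fun s hrun ha hk => ⟨_, s, hrun, ha, fun i hi => hk i ⟨i.isLt.trans_eq ha.symm, hi⟩, rfl⟩
  intro n
  induction n using Nat.strong_induction_on with
  | _ n ih =>
    intro s hrun ha hn
    have hs := hP.invariant_of_run hm hrun
    by_cases hpend : ∃ i, s.Pending i
    · obtain ⟨i, hi⟩ := hpend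
      by_cases hc : ∃ i j, s.CanMatch κ (chainInstance P m) i j
      · obtain ⟨i, j, hc⟩ := hc
        obtain ⟨t, hst, ha', hk⟩ := hs.exists_pair_step hc
        exact hdone t (hrun.tail hst) (ha'.trans ha) hk
      · push Not at hc
        obtain ⟨t, hst, ha', hlt⟩ := hs.exists_wait_step ha hc hi
        exact ih _ (hlt.trans_le hn) t (hrun.tail hst) (ha'.trans ha) le_rfl
    · push Not at hpend
      exact hdone s hrun ha hpend

/-! ### The optimal cost -/

theorem Schedule.Feasible.cost_term_nonneg {m : ℕ} {S : Schedule m} {I : Instance X m}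
    (hS : S.Feasible I) (i : Fin (2 * m)) :
    0 ≤ dist (I.pos i) (I.pos (S.mate i)) / 2 + (S.mtime i - I.atime i) :=
  add_nonneg (div_nonneg dist_nonneg zero_le_two) (sub_nonneg.2 (hS.arrived i))

/-- The schedule that matches the requests `2 k` and `2 k + 1`, at time `0`. -/
def pairSchedule (m : ℕ) : Schedule m where
  mate i := if h : i.val % 2 = 0 then ⟨i.val + 1, by omega⟩ else ⟨i.val - 1, by omega⟩
  mtime _ := 0

theorem pairSchedule_mate_div (m : ℕ) (i : Fin (2 * m)) :
    ((pairSchedule m).mate i).val / 2 = i.val / 2 := by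
  simp only [pairSchedule]
  split_ifs <;> simp only <;> omega

theorem pairSchedule_mate_val_ne (m : ℕ) (i : Fin (2 * m)) :
    ((pairSchedule m).mate i).val ≠ i.val := by
  simp only [pairSchedule]
  split_ifs <;> simp only <;> omega

theorem pairSchedule_feasible {Y : Type*} (P : ℕ → Y) (m : ℕ) :
    (pairSchedule m).Feasible (chainInstance P m) where
  invol i := by
    have h1 := pairSchedule_mate_div m i
    have h2 := pairSchedule_mate_val_ne m i
    have h3 := pairSchedule_mate_div m ((pairSchedule m).mate i)
    have h4 := pairSchedule_mate_val_ne m ((pairSchedule m).mate i)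
    rw [Fin.ext_iff]
    omega
  matched i h := pairSchedule_mate_val_ne m i (congrArg Fin.val h)
  same_time _ := rfl
  arrived _ := le_rfl

theorem opt_chainInstance_le (P : ℕ → X) {m : ℕ} (hm : 2 ≤ m) :
    Opt (chainInstance P m) ≤ dist (P (m - 1)) (P 0) := by
  have hS := pairSchedule_feasible P m
  have hbdd : BddBelow {C | ∃ S : Schedule m, S.Feasible (chainInstance P m) ∧
      S.cost (chainInstance P m) = C} := by
    refine ⟨0, ?_⟩
    rintro _ ⟨S, hS, rfl⟩
    exact Finset.sum_nonneg fun i _ => hS.cost_term_nonneg i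
  refine (csInf_le hbdd ⟨_, hS, rfl⟩).trans ?_
  have hr : 2 * m - 2 < 2 * m := by omega
  have hr' : 2 * m - 1 < 2 * m := by omega
  have hne : (⟨2 * m - 2, hr⟩ : Fin (2 * m)) ≠ ⟨2 * m - 1, hr'⟩ := by
    simp only [ne_eq, Fin.mk.injEq]; omega
  have hdist : ∀ i : Fin (2 * m), i.val / 2 + 1 = m →
      dist ((chainInstance P m).pos i) ((chainInstance P m).pos ((pairSchedule m).mate i)) =
        dist (P (m - 1)) (P 0) := by
    intro i hi
    have h1 := pairSchedule_mate_div m i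
    have h2 := pairSchedule_mate_val_ne m i
    simp only [chainInstance]
    by_cases h : i.val + 1 = 2 * m
    · rw [if_pos h, if_neg (by omega), dist_comm, h1, show i.val / 2 = m - 1 by omega]
    · rw [if_neg h, if_pos (by omega), show i.val / 2 = m - 1 by omega]
  unfold Schedule.cost
  rw [Fintype.sum_eq_add _ _ hne, hdist _ (by simp only; omega), hdist _ (by simp only; omega)]
  · simp only [pairSchedule, chainInstance]
    linarith
  · rintro i ⟨h1, h2⟩
    rw [Ne, Fin.ext_iff] at h1 h2
    simp only at h1 h2
    rw [← chainInstance_pos_eq P (pairSchedule_mate_div m i).symm (by omega)]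
    simp [pairSchedule, chainInstance]

/-- The request at `P (m - 1)` is the only one there, so its partner is at a positive distance. Half
of the least such distance is charged to it. -/
theorem IsChain.opt_pos {P : ℕ → X} (hP : IsChain P) {m : ℕ} (hm : 2 ≤ m) :
    0 < Opt (chainInstance P m) := by
  obtain ⟨ε, hε, hdist⟩ : ∃ ε > 0, ∀ j < m - 1, ε ≤ dist (P (m - 1)) (P j) := by
    obtain ⟨k, hk, hmin⟩ := (Finset.range (m - 1)).exists_min_image
      (fun j => dist (P (m - 1)) (P j)) ⟨0, by simp; omega⟩
    refine ⟨_, dist_pos.2 fun h => ?_, fun j hj => hmin j (Finset.mem_range.2 hj)⟩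
    have := hP.inj h
    have := Finset.mem_range.1 hk
    omega
  refine (half_pos hε).trans_le (le_csInf ⟨_, _, pairSchedule_feasible P m, rfl⟩ ?_)
  rintro _ ⟨S, hS, rfl⟩
  let r : Fin (2 * m) := ⟨2 * m - 2, by omega⟩
  have hr : ε ≤ dist ((chainInstance P m).pos r) ((chainInstance P m).pos (S.mate r)) := by
    have hne : (S.mate r).val ≠ r.val := fun h => hS.matched r (Fin.ext h)
    have hval : r.val = 2 * m - 2 := rfl
    simp only [chainInstance]
    rw [if_neg (by omega), show r.val / 2 = m - 1 by omega]
    split_ifs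
    · exact hdist 0 (by omega)
    · exact hdist _ (by omega)
  refine le_trans ?_ (Finset.single_le_sum (fun i _ => hS.cost_term_nonneg i) (Finset.mem_univ r))
  have := hS.arrived r
  linarith

theorem IsChain.le_competitiveRatio {κ : ℝ} (hκ : 0 ≤ κ) {P : ℕ → X} (hP : IsChain P) {m : ℕ}
    (hm : 2 ≤ m) {A : Instance X m → ℝ} (hA : IsTreeBased κ A) :
    ENNReal.ofReal (κ * dist (P 1) (P 0) / dist (P (m - 1)) (P 0)) ≤ competitiveRatio A := by
  have hpos := hP.opt_pos hm
  refine le_trans (ENNReal.ofReal_le_ofReal ?_)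
    (le_iSup₂ (f := fun (I : Instance X m) (_ : 0 < Opt I) => ENNReal.ofReal (A I / Opt I))
      (chainInstance P m) hpos)
  -- Existence of a complete run makes `A` the cost of some run; the lower bound holds for all of
  -- them.
  have hcost := hP.le_cost hm (hA _ (hP.exists_cost hm))
  have hnn : 0 ≤ κ * dist (P 1) (P 0) := mul_nonneg hκ dist_nonneg
  exact div_le_div₀ (hnn.trans hcost) hcost hpos (opt_chainInstance_le P hm)

end Runs

/-! ### A chain of points on the ring -/

/-- The norm is the distance to some multiple of `h`: those up to 0 are at least `x` away, those
from `h` on at least `h - x`. -/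
theorem le_norm_addCircle {h a x : ℝ} (hh : 0 < h) (h1 : a ≤ x) (h2 : a ≤ h - x) : a ≤ ‖(x : AddCircle h)‖ := by
  rw [AddCircle.norm_eq]
  have key : ∀ n : ℤ, a ≤ |x - n * h| := by
    intro n
    rcases le_or_gt n 0 with hn | hn
    · have : (n : ℝ) ≤ 0 := by exact_mod_cast hn
      refine le_trans ?_ (le_abs_self _)
      nlinarith
    · have : (1 : ℝ) ≤ n := by exact_mod_cast hn
      refine le_trans ?_ (neg_le_abs _)
      nlinarith
  exact key _

/-- The points at arc-length `h (1 - (2 / 3) ^ j)`; the arc from each of them to the origin is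
shrunk by one third in each step. -/
noncomputable def ringChain (h : ℝ) (j : ℕ) : AddCircle h :=
  ((h * (1 - (2 / 3) ^ j) : ℝ) : AddCircle h)

theorem dist_ringChain (h : ℝ) (i j : ℕ) :
    dist (ringChain h j) (ringChain h i) =
      ‖((h * ((2 / 3) ^ i - (2 / 3) ^ j) : ℝ) : AddCircle h)‖ := by
  rw [dist_eq_norm, ringChain, ringChain, ← AddCircle.coe_sub]
  congr 2
  ring

/-- The two hypotheses concern the two arcs. The second arc passes through the origin, and only its
part from `P (j + 1)` to the origin is counted. -/
theorem le_dist_ringChain {h : ℝ} (hh : 0 < h) {i j : ℕ} {a : ℝ}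
    (h1 : a ≤ h * ((2 / 3) ^ i - (2 / 3) ^ (j + 1))) (h2 : a ≤ h * (2 / 3) ^ (j + 1)) :
    a ≤ dist (ringChain h (j + 1)) (ringChain h i) := by
  have hi : ((2 : ℝ) / 3) ^ i ≤ 1 := pow_le_one₀ (by norm_num) (by norm_num)
  rw [dist_ringChain]
  refine le_norm_addCircle hh h1 ?_
  nlinarith

theorem dist_ringChain_succ_le {h : ℝ} (hh : 0 < h) (j : ℕ) :
    dist (ringChain h (j + 1)) (ringChain h j) ≤ h * (2 / 3) ^ j / 3 := by
  rw [dist_ringChain]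
  have hj : (0 : ℝ) < (2 / 3) ^ j := by positivity
  have heq : h * ((2 / 3) ^ j - (2 / 3) ^ (j + 1)) = h * (2 / 3) ^ j / 3 := by ring
  rw [heq]
  exact (QuotientAddGroup.norm_mk_le_norm).trans_eq (abs_of_pos (by positivity))

theorem dist_ringChain_zero_le {h : ℝ} (hh : 0 < h) (j : ℕ) :
    dist (ringChain h j) (ringChain h 0) ≤ h * (2 / 3) ^ j := by
  rw [dist_ringChain]
  have hj : (0 : ℝ) < (2 / 3) ^ j := by positivity
  have heq : ((h * ((2 / 3) ^ 0 - (2 / 3) ^ j) : ℝ) : AddCircle h) =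
      -((h * (2 / 3) ^ j : ℝ) : AddCircle h) := by
    -- Going forward through the origin replaces the arc by its complement.
    rw [show h * ((2 / 3) ^ 0 - (2 / 3) ^ j) = h + -(h * (2 / 3) ^ j) by ring,
      AddCircle.coe_add, AddCircle.coe_period, zero_add, AddCircle.coe_neg]
  rw [heq, norm_neg]
  exact (QuotientAddGroup.norm_mk_le_norm).trans_eq (abs_of_pos (by positivity))

theorem isChain_ringChain {h : ℝ} (hh : 0 < h) : IsChain (ringChain h) where
  inj := by
    have key : ∀ i j, i < j → ringChain h j ≠ ringChain h i := by
      intro i j hij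
      obtain ⟨j, rfl⟩ : ∃ k, j = k + 1 := ⟨j - 1, by omega⟩
      have hj : 0 < h * (2 / 3) ^ j := by positivity
      have hle : ((2 : ℝ) / 3) ^ j ≤ (2 / 3) ^ i :=
        pow_le_pow_of_le_one (by norm_num) (by norm_num) (by omega)
      refine dist_pos.1 ((by positivity : 0 < h * (2 / 3) ^ j / 3).trans_le
        (le_dist_ringChain hh ?_ ?_))
      · rw [pow_succ]; nlinarith
      · rw [pow_succ]; nlinarith
    intro i j hij
    rcases lt_trichotomy i j with hlt | heq | hlt
    · exact absurd hij.symm (key i j hlt)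
    · exact heq
    · exact absurd hij (key j i hlt)
  closest i j hij := by
    have hj : 0 < h * (2 / 3) ^ j := by positivity
    have hle : ((2 : ℝ) / 3) ^ j ≤ (2 / 3) ^ (i + 1) :=
      pow_le_pow_of_le_one (by norm_num) (by norm_num) (by omega)
    -- In units of h(2/3)^j, the predecessor is within 1/3, while the arcs to an earlier point are
    -- at least 3/2 - 2/3 and 2/3. The value 1/2 separates them.
    refine lt_of_le_of_lt (dist_ringChain_succ_le hh j) (lt_of_lt_of_le
      (by linarith : h * (2 / 3) ^ j / 3 < h * (2 / 3) ^ j / 2)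
      (le_dist_ringChain hh ?_ ?_))
    · rw [pow_succ] at hle ⊢; nlinarith
    · rw [pow_succ]; nlinarith

theorem le_dist_ringChain_one {h : ℝ} (hh : 0 < h) :
    h / 3 ≤ dist (ringChain h 1) (ringChain h 0) :=
  le_dist_ringChain hh (j := 0) (by norm_num; linarith) (by norm_num; linarith)

end MPMD

/-! ### Choice of the constants. -/

theorem mainTheorem3 :
    ∃ c : ℝ, 0 < c ∧ ∀ κ : ℝ, 0 < κ → ∃ M : ℕ, ∀ m : ℕ, M ≤ m → ∀ h : ℝ, 0 < h →
      ∀ A : MPMD.Instance (AddCircle h) m → ℝ, MPMD.IsTreeBased κ A →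
        ENNReal.ofReal ((2 : ℝ) ^ (c * (m : ℝ))) ≤ MPMD.competitiveRatio A := by
  -- Since 3/2 = (5/4)(6/5), the growth (5/4)^m is kept and (6/5)^m absorbs κ. The requirement
  -- (5/4)^m (2/3)^(m - 1) ≤ κ/3 amounts to (6/5)^m ≥ 9/(2κ).
  refine ⟨Real.logb 2 (5 / 4), Real.logb_pos (by norm_num) (by norm_num), fun κ hκ => ?_⟩
  obtain ⟨N, hN⟩ := pow_unbounded_of_one_lt (9 / (2 * κ)) (by norm_num : (1 : ℝ) < 6 / 5)
  refine ⟨max N 2, fun m hm h hh A hA => ?_⟩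
  have hm2 : 2 ≤ m := (le_max_right _ _).trans hm
  have hP := MPMD.isChain_ringChain hh
  refine le_trans (ENNReal.ofReal_le_ofReal ?_) (hP.le_competitiveRatio hκ.le hm2 hA)
  have hpos : 0 < dist (MPMD.ringChain h (m - 1)) (MPMD.ringChain h 0) :=
    dist_pos.2 fun heq => by have := hP.inj heq; omega
  rw [Real.rpow_mul (by norm_num), Real.rpow_logb (by norm_num) (by norm_num) (by norm_num),
    Real.rpow_natCast, le_div_iff₀ hpos]
  have hNm : 9 / (2 * κ) ≤ (6 / 5 : ℝ) ^ m :=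
    hN.le.trans (pow_le_pow_right₀ (by norm_num) ((le_max_left _ _).trans hm))
  rw [div_le_iff₀ (by positivity)] at hNm
  have hprod : (5 / 4 : ℝ) ^ m * (2 / 3) ^ m * (6 / 5) ^ m = 1 := by
    rw [← mul_pow, ← mul_pow]
    norm_num
  have hpred : (2 / 3 : ℝ) ^ m = (2 / 3) ^ (m - 1) * (2 / 3) := by
    rw [← pow_succ, Nat.sub_add_cancel (by omega)]
  have hx : (0 : ℝ) ≤ (5 / 4) ^ m * (2 / 3) ^ m := by positivity
  have hbound : (5 / 4 : ℝ) ^ m * (2 / 3) ^ (m - 1) ≤ κ / 3 := by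
    have := mul_le_mul_of_nonneg_left hNm hx
    rw [← mul_assoc, hprod, hpred] at this
    linarith
  calc (5 / 4 : ℝ) ^ m * dist (MPMD.ringChain h (m - 1)) (MPMD.ringChain h 0)
      ≤ (5 / 4) ^ m * (h * (2 / 3) ^ (m - 1)) :=
        mul_le_mul_of_nonneg_left (MPMD.dist_ringChain_zero_le hh _) (by positivity)
    _ = (5 / 4 : ℝ) ^ m * (2 / 3) ^ (m - 1) * h := by ring
    _ ≤ κ / 3 * h := mul_le_mul_of_nonneg_right hbound hh.le
    _ = κ * (h / 3) := by ring
    _ ≤ _ := mul_le_mul_of_nonneg_left (MPMD.le_dist_ringChain_one hh) hκ.le
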